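/- Let $\mathbb{R}^*=\mathbb{R}\setminus\{0\}$ and let $L$ be a bounded operator on $L^2(\mathbb{R}^*,dx)$ with integral kernel $$L(x,y)=\frac{A^{+}(x)A^{-}(y)+A^{-}(x)A^{+}(y)}{x-y},\qquad A^{+}=A\chi_{(0,\infty)},\quad A^{-}=A\chi_{(-\infty,0)},$$ where $A\in C^1(\mathbb{R}^*)\cap L^2(\mathbb{R}^*,dx)$ is real-valued and the (closed) support of $A$ in $\mathbb{R}^*$ is all of $\mathbb{R}^*$. Let $n\ge 0$ and let $\mathfrak p=(p_1^+,\dots,p_n^+;p_1^-,\dots,p_n^-)$ be a $2n$-tuple of distinct points with $p_i^+>0$, $p_i^-<0$ and $A(p_i^{\pm})\neq 0$ for all $i$. Define the bounded function $$g_{\mathfrak p}(x)=\prod_{i=1}^n\left(\frac{x-p_i^+}{x-p_i^-}\chi_{\{x>0\}}+\frac{x-p_i^-}{x-p_i^+}\chi_{\{x<0\}}\right),$$ and identify it with the corresponding multiplication operator. For a kernel $K$ on $\mathbb{R}^*\times\mathbb{R}^*$ and $q\in\mathbb{R}^*$ put $$K^q(x,y)=K(x,y)-\frac{K(x,q)K(q,y)}{K(q,q)}\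 \text{ if } K(q,q)\ne 0,\qquad K^q=K\ \text{ if } K(q,q)=0,$$ and $K^{(q_1,\dots,q_k)}=(\cdots(K^{q_1})^{q_2}\cdots)^{q_k}$. Then $1+L$ and $1+g_{\mathfrak p}Lg_{\mathfrak p}$ are invertible; the operators $K_L:=L(1+L)^{-1}$ and $K_{g_{\mathfrak p}Lg_{\mathfrak p}}:=g_{\mathfrak p}Lg_{\mathfrak p}(1+g_{\mathfrak p}Lg_{\mathfrak p})^{-1}$ have integral kernels that are continuous on $\mathbb{R}^*\times\mathbb{R}^*$; and for these continuous kernels $$K_L^{\mathfrak p}(x,y)=K_{g_{\mathfrak p}Lg_{\mathfrak p}}(x,y)\qquad\text{for all }x,y\in\mathbb{R}^*,$$ whatever the order in which the $2n$ points are used in the iteration defining $K_L^{\mathfrak p}$. In particular, for $n=1$, $K_L^{(p^+,p^-)}=K_{g_{\mathfrak p}Lg_{\mathfrak p}}$. -/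

import Mathlib

open MeasureTheory Set
open scoped ENNReal

noncomputable section

namespace PalmKernel

/-- The Hilbert space `L²(ℝ*, dx)` of complex-valued functions. The origin is Lebesgue-null, so it
is the same as `L²(ℝ, dx)`. -/
abbrev H : Type := Lp ℂ 2 (volume : Measure ℝ)

/-- `K` is an integral kernel of the bounded operator `T`: for every `f ∈ L²`,
`(T f)(x) = ∫ K(x,y) f(y) dy` for almost every `x`, the integral being absolutely convergent. -/
def IsIntegralKernel (K : ℝ → ℝ → ℂ) (T : H →L[ℂ] H) : Prop :=
  ∀ f : H, ∀ᵐ x : ℝ, Integrable (fun y => K x y * f y) ∧ (T f) x = ∫ y, K x y * f y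

/-- `K` is the continuous integral kernel of `T` on `ℝ* × ℝ*`. Its values at the points of
`ℝ* × ℝ*` are determined by `T`; values with a zero coordinate are irrelevant. -/
def IsContinuousKernel (K : ℝ → ℝ → ℂ) (T : H →L[ℂ] H) : Prop :=
  ContinuousOn (fun z : ℝ × ℝ => K z.1 z.2) ({0}ᶜ ×ˢ {0}ᶜ) ∧ IsIntegralKernel K T

/-- `A⁺ = A χ_{(0,∞)}`. -/
def posPart (A : ℝ → ℝ) : ℝ → ℝ := (Ioi 0).indicator A

/-- `A⁻ = A χ_{(-∞,0)}`. -/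
def negPart (A : ℝ → ℝ) : ℝ → ℝ := (Iio 0).indicator A

/-- The bounded operator `L` on `L²(ℝ*)` has the integral kernel
`(A⁺(x) A⁻(y) + A⁻(x) A⁺(y)) / (x - y)`, where `A` is a real function of class `C¹` on `ℝ*`,
square integrable, and whose (closed) support in `ℝ*` is all of `ℝ*`. -/
structure IsAdmissible (L : H →L[ℂ] H) (A : ℝ → ℝ) : Prop where
  contDiffOn : ContDiffOn ℝ 1 A {0}ᶜ
  memLp : MemLp A 2 (volume : Measure ℝ)
  fullSupport : ({0}ᶜ : Set ℝ) ⊆ closure (Function.support A)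
  kernel : IsIntegralKernel
    (fun x y => (((posPart A x * negPart A y + negPart A x * posPart A y) / (x - y) : ℝ) : ℂ)) L

/-- `K_L = L (1 + L)⁻¹` (meaningful when `1 + L` is invertible). -/
def KOp (L : H →L[ℂ] H) : H →L[ℂ] H := L * Ring.inverse (1 + L)

/-- One step of the Palm reduction: `K^q(x,y) = K(x,y) - K(x,q) K(q,y) / K(q,q)` if
`K(q,q) ≠ 0`, and `K^q = K` otherwise. -/
def palmStep (K : ℝ → ℝ → ℂ) (q : ℝ) : ℝ → ℝ → ℂ :=
  if K q q = 0 then K else fun x y => K x y - K x q * K q y / K q q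

/-- The iterated Palm kernel `K^{(q₁,…,q_k)} = (⋯(K^{q₁})^{q₂}⋯)^{q_k}`. -/
def palmKernel (K : ℝ → ℝ → ℂ) (q : List ℝ) : ℝ → ℝ → ℂ := q.foldl palmStep K

/-- The weight
`g_𝔭(x) = ∏ᵢ ((x - pᵢ⁺)/(x - pᵢ⁻) χ_{x > 0} + (x - pᵢ⁻)/(x - pᵢ⁺) χ_{x < 0})`. -/
def weight {n : ℕ} (pp pm : Fin n → ℝ) (x : ℝ) : ℝ :=
  ∏ i, ((Ioi 0).indicator (fun x => (x - pp i) / (x - pm i)) x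
    + (Iio 0).indicator (fun x => (x - pm i) / (x - pp i)) x)

/-- Multiplication by an essentially bounded function, as a bounded operator on `L²`. -/
def mulOp (g : ℝ → ℝ) (hg : MemLp (fun x => (g x : ℂ)) ∞ (volume : Measure ℝ)) : H →L[ℂ] H :=
  (ContinuousLinearMap.mul ℂ ℂ).holderL volume ∞ 2 2 hg.toLp

theorem abs_div_sub_le {x a b : ℝ} (hx : 0 < x) (ha : 0 < a) (hb : b < 0) :
    |(x - a) / (x - b)| ≤ 1 + a / (-b) := by
  have h1 : 0 < x - b := by linarith
  have h2 : 0 < -b := by linarith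
  have h3 : 0 ≤ a / (-b) := (div_pos ha h2).le
  have h4 : a / (-b) * (-b) = a := div_mul_cancel₀ a h2.ne'
  rw [abs_div, abs_of_pos h1, div_le_iff₀ h1, abs_le]
  constructor <;> nlinarith [mul_nonneg h3 hx.le]

theorem weight_memLp {n : ℕ} {pp pm : Fin n → ℝ} (hpp : ∀ i, 0 < pp i) (hpm : ∀ i, pm i < 0) :
    MemLp (fun x => (weight pp pm x : ℂ)) ∞ (volume : Measure ℝ) := by
  have hm : Measurable (weight pp pm) := by
    unfold weight
    refine Finset.measurable_prod _ fun i _ => ?_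
    refine (Measurable.indicator ?_ measurableSet_Ioi).add
      (Measurable.indicator ?_ measurableSet_Iio) <;> fun_prop
  refine memLp_top_of_bound (Complex.measurable_ofReal.comp hm).aestronglyMeasurable
    (∏ i, ((1 + pp i / (-pm i)) + (1 + (-pm i) / pp i))) (Filter.Eventually.of_forall fun x => ?_)
  rw [Complex.norm_real, Real.norm_eq_abs, weight, Finset.abs_prod]
  refine Finset.prod_le_prod (fun i _ => abs_nonneg _) fun i _ => ?_
  have h1 : 0 < pp i / (-pm i) := div_pos (hpp i) (neg_pos.2 (hpm i))
  have h2 : 0 < (-pm i) / pp i := div_pos (neg_pos.2 (hpm i)) (hpp i)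
  rcases lt_trichotomy x 0 with hx | rfl | hx
  · have h := abs_div_sub_le (neg_pos.2 hx) (neg_pos.2 (hpm i)) (neg_lt_zero.2 (hpp i))
    have e : (-x - -pm i) / (-x - -pp i) = (x - pm i) / (x - pp i) := by
      rw [← neg_div_neg_eq]; congr 1 <;> ring
    rw [e, neg_neg] at h
    simp only [indicator, mem_Ioi, mem_Iio, hx, hx.not_gt, if_true, if_false, zero_add]
    linarith
  · simp only [indicator, mem_Ioi, mem_Iio, lt_irrefl, if_false, add_zero, abs_zero]
    linarith
  · have h := abs_div_sub_le hx (hpp i) (hpm i)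
    simp only [indicator, mem_Ioi, mem_Iio, hx, hx.not_gt, if_true, if_false, add_zero]
    linarith

/-- The operator `g_𝔭 L g_𝔭`. -/
def weightConj {n : ℕ} (pp pm : Fin n → ℝ) (hpp : ∀ i, 0 < pp i) (hpm : ∀ i, pm i < 0)
    (L : H →L[ℂ] H) : H →L[ℂ] H :=
  mulOp (weight pp pm) (weight_memLp hpp hpm) * L * mulOp (weight pp pm) (weight_memLp hpp hpm)

end PalmKernel

end

/-! Write `k` for the kernel of `L`, `r_x = k(x, ·)`, `R = (1 + L)⁻¹`. As `k` is real and
antisymmetric, `L` is skew-adjoint, so `1 + L` is invertible, and `L R = L - L R L` gives the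
continuous kernel `K(x, y) = k(x, y) + ⟪r_x, R r_y⟫` of `K_L`.

A Palm step is a Schur complement at one point. On the given points the matrix of `k` is skew, so
the real part of the form of `K` at `c` is `‖R w‖²` with `w = ∑ c_q r_q`. It is positive, because
the `r_q` are linearly independent (`sum_smul_cauchyRow_ne_zero`). Positivity survives Schur
complements, so no Palm step degenerates and the order of the points is immaterial
(`palmKernel_perm`).

Hence the points may be removed in pairs `(p, m)`. Reducing `K` at a pair matches taking the Schur
complement of `L` itself at that pair (`IsCauchyOperator.palm_pair`), and by the Cauchy determinant
identity this complement has kernel `g k g` (`cauchyKernel_pairWeight`). The result is again of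
Cauchy type, with `g A` in place of `A`, and induction on the number of pairs finishes. -/

namespace PalmKernel

open scoped InnerProductSpace

noncomputable section

/-! ### Integral kernels, rank-one perturbations and skew-adjoint operators -/

/-- A continuous integral kernel is determined on `ℝ* × ℝ*` by its operator. -/
theorem IsContinuousKernel.unique {K K' : ℝ → ℝ → ℂ} {T : H →L[ℂ] H}
    (hK : IsContinuousKernel K T) (hK' : IsContinuousKernel K' T) {x y : ℝ}
    (hx : x ≠ 0) (hy : y ≠ 0) : K x y = K' x y := by
  by_contra hne
  set D : ℝ × ℝ → ℂ := fun z => K z.1 z.2 - K' z.1 z.2 with hD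
  have hD0 : 0 < ‖D (x, y)‖ / 2 := by
    have : 0 < ‖D (x, y)‖ := norm_pos_iff.2 (sub_ne_zero.2 hne)
    linarith
  have hopen : IsOpen (({0}ᶜ : Set ℝ) ×ˢ ({0}ᶜ : Set ℝ)) :=
    isOpen_compl_singleton.prod isOpen_compl_singleton
  have hcont : ContinuousAt D (x, y) :=
    (hK.1.sub hK'.1).continuousAt (hopen.mem_nhds ⟨hx, hy⟩)
  obtain ⟨r, hr, hball⟩ := Metric.continuousAt_iff.1 hcont _ hD0
  set V : Set ℝ := Metric.ball y r
  have hVfin : volume V ≠ ∞ := measure_ball_lt_top.ne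
  -- One test function suffices: for almost every `x'` near `x` both kernels integrate over `V` to
  -- `(T f) x'`, so `D (x', ·)` has integral zero on `V`, although it stays within `‖D (x, y)‖ / 2`
  -- of `D (x, y)`.
  set f : H := indicatorConstLp 2 (measurableSet_ball : MeasurableSet V) hVfin (1 : ℂ) with hf
  have hfV : (f : ℝ → ℂ) =ᵐ[volume] V.indicator fun _ => (1 : ℂ) := indicatorConstLp_coeFn
  have hpos : volume (Metric.ball x r) ≠ 0 := (Metric.measure_ball_pos volume x hr).ne'
  obtain ⟨x', hx', ⟨hi, he⟩, hi', he'⟩ : ∃ x' ∈ Metric.ball x r,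
      (Integrable (fun y => K x' y * f y) ∧ (T f) x' = ∫ y, K x' y * f y) ∧
      (Integrable (fun y => K' x' y * f y) ∧ (T f) x' = ∫ y, K' x' y * f y) := by
    by_contra! hcon
    apply hpos
    have := (hK.2 f).and (hK'.2 f)
    refine measure_mono_null (fun z hz => ?_) this
    rintro ⟨h1, h2⟩
    exact hcon z hz h1 h2.1 h2.2
  have hDV : (fun z => K x' z * f z - K' x' z * f z) =ᵐ[volume]
      V.indicator fun z => D (x', z) := by
    filter_upwards [hfV] with z hz
    rw [hz]
    by_cases h : z ∈ V <;> simp [h, hD]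
  have hint : IntegrableOn (fun z => D (x', z)) V :=
    (integrable_indicator_iff measurableSet_ball).1 ((hi.sub hi').congr hDV)
  have hzero : ∫ z in V, D (x', z) = 0 := by
    rw [← integral_indicator measurableSet_ball, ← integral_congr_ae hDV,
      integral_sub hi hi', ← he, ← he', sub_self]
  have hbound : ‖∫ z in V, (D (x', z) - D (x, y))‖ ≤ ‖D (x, y)‖ / 2 * volume.real V := by
    refine norm_setIntegral_le_of_norm_le_const hVfin.lt_top fun z hz => ?_
    rw [← dist_eq_norm]
    refine (hball ?_).le
    rw [Prod.dist_eq]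
    exact max_lt hx' hz
  have hc : IntegrableOn (fun _ : ℝ => D (x, y)) V := integrableOn_const hVfin
  have hVpos : 0 < volume.real V :=
    ENNReal.toReal_pos (Metric.measure_ball_pos volume y hr).ne' hVfin
  rw [integral_sub hint hc, hzero, zero_sub, norm_neg, setIntegral_const, norm_smul,
    Real.norm_of_nonneg hVpos.le] at hbound
  nlinarith

theorem IsIntegralKernel.operator_unique {K : ℝ → ℝ → ℂ} {T T' : H →L[ℂ] H}
    (h : IsIntegralKernel K T) (h' : IsIntegralKernel K T') : T = T' := by
  ext1 f
  apply Lp.ext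
  filter_upwards [h f, h' f] with x hx hx'
  rw [hx.2, hx'.2]

theorem IsIntegralKernel.congr {K K' : ℝ → ℝ → ℂ} {T : H →L[ℂ] H} (h : IsIntegralKernel K T)
    (hKK : ∀ x y, x ≠ 0 → y ≠ 0 → K x y = K' x y) : IsIntegralKernel K' T := by
  intro f
  filter_upwards [h f, Measure.ae_ne volume (0 : ℝ)] with x hx hx0
  have he : (fun y => K x y * f y) =ᵐ[volume] fun y => K' x y * f y := by
    filter_upwards [Measure.ae_ne volume (0 : ℝ)] with y hy0
    rw [hKK x y hx0 hy0]
  exact ⟨hx.1.congr he, hx.2.trans (integral_congr_ae he)⟩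

/-- The functional `φ` is `f ↦ ∫ b f`. -/
def IsRow (b : ℝ → ℂ) (φ : H →L[ℂ] ℂ) : Prop :=
  ∀ f : H, Integrable (fun y => b y * f y) ∧ φ f = ∫ y, b y * f y

theorem IsRow.sub_const_mul {b b' : ℝ → ℂ} {φ φ' : H →L[ℂ] ℂ} (h : IsRow b φ) (h' : IsRow b' φ')
    (c : ℂ) : IsRow (fun y => b y - c * b' y) (φ - c • φ') := by
  intro f
  have e : (fun y => (b y - c * b' y) * f y) = fun y => b y * f y - c * (b' y * f y) := by
    ext y; ring
  rw [e]
  refine ⟨(h f).1.sub ((h' f).1.const_mul c), ?_⟩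
  rw [integral_sub (h f).1 ((h' f).1.const_mul c), integral_const_mul, ← (h f).2, ← (h' f).2]
  simp

/-- Subtracting a rank-one operator from `T` subtracts a rank-one kernel. -/
theorem IsIntegralKernel.sub_rankOne {K : ℝ → ℝ → ℂ} {T : H →L[ℂ] H} (h : IsIntegralKernel K T)
    {a b : ℝ → ℂ} {ψ : H} {φ : H →L[ℂ] ℂ} (ha : (ψ : ℝ → ℂ) =ᵐ[volume] a) (hb : IsRow b φ)
    (c : ℂ) :
    IsIntegralKernel (fun x y => K x y - c * (a x * b y)) (T - c • φ.smulRight ψ) := by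
  intro f
  have hT : ((T - c • φ.smulRight ψ) f : H) = T f - (c * φ f) • ψ := by
    simp [mul_smul]
  filter_upwards [h f, ha, Lp.coeFn_sub (T f) ((c * φ f) • ψ), Lp.coeFn_smul (c * φ f) ψ]
    with x hx hax h1 h2
  have e : (fun y => (K x y - c * (a x * b y)) * f y) =
      fun y => K x y * f y - c * a x * (b y * f y) := by
    ext y; ring
  rw [e]
  refine ⟨hx.1.sub ((hb f).1.const_mul _), ?_⟩
  rw [integral_sub hx.1 ((hb f).1.const_mul _), integral_const_mul, ← hx.2, ← (hb f).2, hT, h1,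
    Pi.sub_apply, h2, Pi.smul_apply, hax, smul_eq_mul]
  ring

theorem isRow_inner {b : ℝ → ℂ} {r : H} (h : (fun y => (starRingEnd ℂ) (r y)) =ᵐ[volume] b) :
    IsRow b (innerSL ℂ r) := by
  intro f
  have e : (fun y => ⟪r y, f y⟫_ℂ) =ᵐ[volume] fun y => b y * f y := by
    filter_upwards [h] with y hy
    rw [← hy, RCLike.inner_apply, mul_comm]
  exact ⟨(L2.integrable_inner r f).congr e, by
    rw [innerSL_apply_apply, L2.inner_def]; exact integral_congr_ae e⟩

/-- `1 + L` is invertible when `L` is skew-adjoint. -/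
theorem isUnit_one_add_of_star_eq_neg {L : H →L[ℂ] H} (h : star L = -L) : IsUnit (1 + L) := by
  -- The spectrum of a self-adjoint operator is real, so it misses `-I`, and `1 + L = I (-I - I L)`.
  have hs : IsSelfAdjoint (Complex.I • L) := by
    rw [isSelfAdjoint_iff, star_smul, h]; simp
  have hn : -Complex.I ∉ spectrum ℂ (Complex.I • L) := fun hm => by
    simpa using hs.im_eq_zero_of_mem_spectrum hm
  rw [spectrum.notMem_iff] at hn
  have e : 1 + L = algebraMap ℂ (H →L[ℂ] H) Complex.I *
      (algebraMap ℂ (H →L[ℂ] H) (-Complex.I) - Complex.I • L) := by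
    rw [Algebra.algebraMap_eq_smul_one, Algebra.algebraMap_eq_smul_one, smul_mul_assoc, one_mul,
      smul_sub, smul_smul, smul_smul]
    simp
  rw [e]
  exact ((isUnit_iff_ne_zero.2 Complex.I_ne_zero).map (algebraMap ℂ (H →L[ℂ] H))).mul hn

/-- Since `1 + L` is invertible, a right inverse `1 - T` is the inverse, and `L (1 + L)⁻¹ = 1 - (1 +
L)⁻¹`. -/
theorem kOp_eq_of_mul_eq_one {L T : H →L[ℂ] H} (hu : IsUnit (1 + L))
    (h : (1 + L) * (1 - T) = 1) : KOp L = T := by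
  have hi : Ring.inverse (1 + L) = 1 - T := by
    calc _ = Ring.inverse (1 + L) * ((1 + L) * (1 - T)) := by rw [h, mul_one]
      _ = 1 - T := by rw [← mul_assoc, Ring.inverse_mul_cancel _ hu, one_mul]
  rw [KOp, hi]
  have : L * (1 - T) = (1 + L) * (1 - T) - (1 - T) := by noncomm_ring
  rw [this, h]; abel

/-! ### The Cauchy kernel and its rows -/

/-- The kernel `(A⁺(x) A⁻(y) + A⁻(x) A⁺(y)) / (x - y)`. -/
def cauchyKernel (A : ℝ → ℝ) (x y : ℝ) : ℝ :=
  (posPart A x * negPart A y + negPart A x * posPart A y) / (x - y)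

theorem cauchyKernel_swap (A : ℝ → ℝ) (x y : ℝ) : cauchyKernel A y x = -cauchyKernel A x y := by
  rw [cauchyKernel, cauchyKernel, ← neg_sub x y, div_neg]
  ring

theorem cauchyKernel_of_pos_neg (A : ℝ → ℝ) {x y : ℝ} (hx : 0 < x) (hy : y < 0) :
    cauchyKernel A x y = A x * A y / (x - y) := by
  simp [cauchyKernel, posPart, negPart, hx, hy, hx.le, hy.le]

theorem cauchyKernel_of_neg_pos (A : ℝ → ℝ) {x y : ℝ} (hx : x < 0) (hy : 0 < y) :
    cauchyKernel A x y = A x * A y / (x - y) := by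
  simp [cauchyKernel, posPart, negPart, hx, hy, hx.le, hy.le]

theorem cauchyKernel_of_pos_pos (A : ℝ → ℝ) {x y : ℝ} (hx : 0 < x) (hy : 0 < y) :
    cauchyKernel A x y = 0 := by
  simp [cauchyKernel, posPart, negPart, hx, hy, hx.le, hy.le]

theorem cauchyKernel_of_neg_neg (A : ℝ → ℝ) {x y : ℝ} (hx : x < 0) (hy : y < 0) :
    cauchyKernel A x y = 0 := by
  simp [cauchyKernel, posPart, negPart, hx, hy, hx.le, hy.le]

theorem cauchyKernel_zero_left (A : ℝ → ℝ) (y : ℝ) : cauchyKernel A 0 y = 0 := by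
  simp [cauchyKernel, posPart, negPart]

theorem cauchyKernel_zero_right (A : ℝ → ℝ) (x : ℝ) : cauchyKernel A x 0 = 0 := by
  simp [cauchyKernel, posPart, negPart]

theorem cauchyKernel_self (A : ℝ → ℝ) (x : ℝ) : cauchyKernel A x x = 0 := by
  simp [cauchyKernel]

/-- The kernel lives on pairs of opposite sign, where `|x - y| = |x| + |y| ≥ |x|`. Rows are thus in
`L²`, but the bound degenerates at the origin. -/
theorem abs_cauchyKernel_le (A : ℝ → ℝ) (x y : ℝ) :
    |cauchyKernel A x y| ≤ |A x| / |x| * |A y| := by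
  have h0 : 0 ≤ |A x| / |x| * |A y| := by positivity
  rcases lt_trichotomy x 0 with hx | rfl | hx <;> rcases lt_trichotomy y 0 with hy | rfl | hy
  · rwa [cauchyKernel_of_neg_neg A hx hy, abs_zero]
  · rwa [cauchyKernel_zero_right, abs_zero]
  · rw [cauchyKernel_of_neg_pos A hx hy, abs_div, abs_mul, div_mul_eq_mul_div]
    have : |x| ≤ |x - y| := by
      rw [abs_of_neg hx, abs_of_neg (by linarith)]; linarith
    have hx' : 0 < |x| := abs_pos.2 hx.ne
    gcongr
  · rw [cauchyKernel_zero_left]; simp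
  · rw [cauchyKernel_zero_left]; simp
  · rw [cauchyKernel_zero_left]; simp
  · rw [cauchyKernel_of_pos_neg A hx hy, abs_div, abs_mul, div_mul_eq_mul_div]
    have : |x| ≤ |x - y| := by
      rw [abs_of_pos hx, abs_of_pos (by linarith)]; linarith
    have hx' : 0 < |x| := abs_pos.2 hx.ne'
    gcongr
  · rwa [cauchyKernel_zero_right, abs_zero]
  · rwa [cauchyKernel_of_pos_pos A hx hy, abs_zero]

/-- The bounded operator `L` has the kernel `cauchyKernel A`, with `A` continuous on `ℝ*` and
square integrable. -/
structure IsCauchyOperator (L : H →L[ℂ] H) (A : ℝ → ℝ) : Prop where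
  continuousOn : ContinuousOn A {0}ᶜ
  memLp : MemLp A 2 (volume : Measure ℝ)
  kernel : IsIntegralKernel (fun x y => (cauchyKernel A x y : ℂ)) L

theorem IsAdmissible.isCauchyOperator {L : H →L[ℂ] H} {A : ℝ → ℝ} (h : IsAdmissible L A) :
    IsCauchyOperator L A :=
  ⟨h.contDiffOn.continuousOn, h.memLp, h.kernel⟩

theorem aestronglyMeasurable_posPart {A : ℝ → ℝ} (hA : AEStronglyMeasurable A) :
    AEStronglyMeasurable (posPart A) := hA.indicator measurableSet_Ioi

theorem aestronglyMeasurable_negPart {A : ℝ → ℝ} (hA : AEStronglyMeasurable A) :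
    AEStronglyMeasurable (negPart A) := hA.indicator measurableSet_Iio

theorem aestronglyMeasurable_cauchyKernel_prod {A : ℝ → ℝ} (hA : AEStronglyMeasurable A) :
    AEStronglyMeasurable (fun z : ℝ × ℝ => cauchyKernel A z.1 z.2)
      ((volume : Measure ℝ).prod volume) := by
  have hp := aestronglyMeasurable_posPart hA
  have hn := aestronglyMeasurable_negPart hA
  refine AEStronglyMeasurable.div₀ ((hp.comp_fst.mul hn.comp_snd).add
    (hn.comp_fst.mul hp.comp_snd)) ?_
  exact (continuous_fst.sub continuous_snd).aestronglyMeasurable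

theorem aestronglyMeasurable_cauchyKernel_row {A : ℝ → ℝ} (hA : AEStronglyMeasurable A) (x : ℝ) :
    AEStronglyMeasurable (cauchyKernel A x) := by
  have hp := aestronglyMeasurable_posPart hA
  have hn := aestronglyMeasurable_negPart hA
  refine AEStronglyMeasurable.div₀ ((hn.const_mul _).add (hp.const_mul _)) ?_
  exact (continuous_const.sub continuous_id).aestronglyMeasurable

theorem memLp_cauchyKernel_row {A : ℝ → ℝ} (hA : MemLp A 2 (volume : Measure ℝ)) (x : ℝ) :
    MemLp (fun y => (cauchyKernel A x y : ℂ)) 2 (volume : Measure ℝ) := by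
  refine MemLp.ofReal (hA.of_le_mul (c := |A x| / |x|)
    (aestronglyMeasurable_cauchyKernel_row hA.1 x) (Filter.Eventually.of_forall fun y => ?_))
  exact abs_cauchyKernel_le A x y

/-- The row `cauchyKernel A x ·` as an element of `L²`. -/
def cauchyRow {A : ℝ → ℝ} (hA : MemLp A 2 (volume : Measure ℝ)) (x : ℝ) : H :=
  (memLp_cauchyKernel_row hA x).toLp

theorem coeFn_cauchyRow {A : ℝ → ℝ} (hA : MemLp A 2 (volume : Measure ℝ)) (x : ℝ) :
    (cauchyRow hA x : ℝ → ℂ) =ᵐ[volume] fun y => (cauchyKernel A x y : ℂ) :=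
  MemLp.coeFn_toLp _

theorem isRow_cauchyRow {A : ℝ → ℝ} (hA : MemLp A 2 (volume : Measure ℝ)) (x : ℝ) :
    IsRow (fun y => (cauchyKernel A x y : ℂ)) (innerSL ℂ (cauchyRow hA x)) := by
  refine isRow_inner ?_
  filter_upwards [coeFn_cauchyRow hA x] with y hy
  rw [hy, Complex.conj_ofReal]

/-- `x ↦ cauchyRow hA x` is continuous on `ℝ*`. -/
theorem continuousOn_cauchyRow {A : ℝ → ℝ} (hA : MemLp A 2 (volume : Measure ℝ))
    (hc : ContinuousOn A {0}ᶜ) : ContinuousOn (cauchyRow hA) {0}ᶜ := by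
  intro x hx
  have hx : x ≠ 0 := hx
  apply ContinuousAt.continuousWithinAt
  have hAx : ContinuousAt A x := hc.continuousAt (isOpen_compl_singleton.mem_nhds hx)
  set a : H := (hA.ofReal (K := ℂ)).toLp
  have ha : (a : ℝ → ℂ) =ᵐ[volume] fun y => (A y : ℂ) := MemLp.coeFn_toLp _
  rw [ContinuousAt, tendsto_iff_norm_sub_tendsto_zero]
  have hlim : Filter.Tendsto (fun z => (|A z - A x| / |x| + |A z| * |z - x| / (|z| * |x|)) * ‖a‖)
      (nhds x) (nhds 0) := by
    have : ContinuousAt (fun z => (|A z - A x| / |x| + |A z| * |z - x| / (|z| * |x|)) * ‖a‖) x := by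
      refine ContinuousAt.mul (ContinuousAt.add ?_ (ContinuousAt.div ?_ ?_ ?_)) continuousAt_const
      · exact (hAx.sub continuousAt_const).abs.div_const _
      · exact hAx.abs.mul (continuousAt_id.sub continuousAt_const).abs
      · exact continuousAt_id.abs.mul continuousAt_const
      · exact mul_ne_zero (abs_ne_zero.2 hx) (abs_ne_zero.2 hx)
    simpa [ContinuousAt] using this
  -- For `z` on the side of `x`, the difference of rows is at most `|A y|` times a factor
  -- independent of `y`, and that factor tends to zero by `hlim`.
  have key : ∀ z y : ℝ, 0 < z * x → |cauchyKernel A z y - cauchyKernel A x y| ≤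
      (|A z - A x| / |x| + |A z| * |z - x| / (|z| * |x|)) * |A y| := by
    intro z y hzx
    have h0 : 0 ≤ (|A z - A x| / |x| + |A z| * |z - x| / (|z| * |x|)) * |A y| := by positivity
    have main : z * y < 0 → |A z * A y / (z - y) - A x * A y / (x - y)| ≤
        (|A z - A x| / |x| + |A z| * |z - x| / (|z| * |x|)) * |A y| := by
      intro hzy
      have hz0 : z ≠ 0 := by rintro rfl; simp at hzx
      have hxy : x * y < 0 := by
        by_contra! h
        nlinarith [mul_nonneg (sq_nonneg z) h, mul_neg_of_pos_of_neg hzx hzy]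
      have hz : |z| ≤ |z - y| := by
        apply sq_le_sq.1; nlinarith [sq_nonneg y]
      have hx' : |x| ≤ |x - y| := by
        apply sq_le_sq.1; nlinarith [sq_nonneg y]
      have pz : 0 < |z| := abs_pos.2 hz0
      have px : 0 < |x| := abs_pos.2 hx
      have nz : z - y ≠ 0 := abs_pos.1 (pz.trans_le hz)
      have nx : x - y ≠ 0 := abs_pos.1 (px.trans_le hx')
      have e : A z * A y / (z - y) - A x * A y / (x - y) =
          ((A z - A x) / (x - y) + A z * (-(z - x)) / ((z - y) * (x - y))) * A y := by
        field_simp; ring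
      rw [e, abs_mul]
      gcongr
      refine (abs_add_le _ _).trans ?_
      rw [abs_div, abs_div, abs_mul, abs_mul, abs_neg]
      gcongr
    rcases lt_trichotomy y 0 with hy | rfl | hy
    · rcases lt_or_gt_of_ne hx with hxn | hxp
      · have hz : z < 0 := by by_contra! h; nlinarith
        rwa [cauchyKernel_of_neg_neg A hz hy, cauchyKernel_of_neg_neg A hxn hy, sub_zero, abs_zero]
      · have hz : 0 < z := by by_contra! h; nlinarith
        rw [cauchyKernel_of_pos_neg A hz hy, cauchyKernel_of_pos_neg A hxp hy]
        exact main (mul_neg_of_pos_of_neg hz hy)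
    · rwa [cauchyKernel_zero_right, cauchyKernel_zero_right, sub_zero, abs_zero]
    · rcases lt_or_gt_of_ne hx with hxn | hxp
      · have hz : z < 0 := by by_contra! h; nlinarith
        rw [cauchyKernel_of_neg_pos A hz hy, cauchyKernel_of_neg_pos A hxn hy]
        exact main (mul_neg_of_neg_of_pos hz hy)
      · have hz : 0 < z := by by_contra! h; nlinarith
        rwa [cauchyKernel_of_pos_pos A hz hy, cauchyKernel_of_pos_pos A hxp hy, sub_zero, abs_zero]
  refine squeeze_zero' (Filter.Eventually.of_forall fun _ => norm_nonneg _) ?_ hlim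
  have hnear : ∀ᶠ z in nhds x, 0 < z * x :=
    (continuousAt_id.mul continuousAt_const).eventually (lt_mem_nhds (mul_self_pos.2 hx))
  filter_upwards [hnear] with z hz
  refine Lp.norm_le_mul_norm_of_ae_le_mul ?_
  filter_upwards [coeFn_cauchyRow hA z, coeFn_cauchyRow hA x, ha,
    Lp.coeFn_sub (cauchyRow hA z) (cauchyRow hA x)] with y h1 h2 h3 h4
  rw [h4, Pi.sub_apply, h1, h2, h3, ← Complex.ofReal_sub, Complex.norm_real, Complex.norm_real]
  exact key z y hz

/-- The denominator vanishes only on the diagonal, and off the axes the diagonal lies in the open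
same-sign quadrants, where the kernel is identically zero. -/
theorem continuousOn_cauchyKernel {A : ℝ → ℝ} (hc : ContinuousOn A {0}ᶜ) :
    ContinuousOn (fun z : ℝ × ℝ => cauchyKernel A z.1 z.2) ({0}ᶜ ×ˢ {0}ᶜ) := by
  rintro ⟨x, y⟩ ⟨hx, hy⟩
  have hx : x ≠ 0 := hx
  have hy : y ≠ 0 := hy
  apply ContinuousAt.continuousWithinAt
  have hAx : ContinuousAt A x := hc.continuousAt (isOpen_compl_singleton.mem_nhds hx)
  have hAy : ContinuousAt A y := hc.continuousAt (isOpen_compl_singleton.mem_nhds hy)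
  have hquot (hne : x - y ≠ 0) :
      ContinuousAt (fun z : ℝ × ℝ => A z.1 * A z.2 / (z.1 - z.2)) (x, y) :=
    ((hAx.comp_of_eq continuousAt_fst rfl).mul (hAy.comp_of_eq continuousAt_snd rfl)).div
      (continuousAt_fst.sub continuousAt_snd) hne
  rcases lt_or_gt_of_ne hx with hx' | hx' <;> rcases lt_or_gt_of_ne hy with hy' | hy'
  · refine (continuousAt_const (y := (0 : ℝ))).congr ?_
    filter_upwards [continuousAt_fst.eventually (gt_mem_nhds hx'),
      continuousAt_snd.eventually (gt_mem_nhds hy')] with z h1 h2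
    exact (cauchyKernel_of_neg_neg A h1 h2).symm
  · refine (hquot (by linarith)).congr ?_
    filter_upwards [continuousAt_fst.eventually (gt_mem_nhds hx'),
      continuousAt_snd.eventually (lt_mem_nhds hy')] with z h1 h2
    exact (cauchyKernel_of_neg_pos A h1 h2).symm
  · refine (hquot (by linarith)).congr ?_
    filter_upwards [continuousAt_fst.eventually (lt_mem_nhds hx'),
      continuousAt_snd.eventually (gt_mem_nhds hy')] with z h1 h2
    exact (cauchyKernel_of_pos_neg A h1 h2).symm
  · refine (continuousAt_const (y := (0 : ℝ))).congr ?_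
    filter_upwards [continuousAt_fst.eventually (lt_mem_nhds hx'),
      continuousAt_snd.eventually (lt_mem_nhds hy')] with z h1 h2
    exact (cauchyKernel_of_pos_pos A h1 h2).symm

/-! ### Skew-adjointness -/

theorem IsCauchyOperator.ae_apply {L : H →L[ℂ] H} {A : ℝ → ℝ} (h : IsCauchyOperator L A) (f : H) :
    ∀ᵐ x, (L f) x = ⟪cauchyRow h.memLp x, f⟫_ℂ := by
  filter_upwards [h.kernel f] with x hx
  rw [hx.2, ← innerSL_apply_apply, ((isRow_cauchyRow h.memLp x) f).2]

/-- `⟪L f, g⟫ = -⟪f, L g⟫` for `f` vanishing in a neighbourhood of the origin. -/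
theorem IsCauchyOperator.inner_apply_of_vanishing {L : H →L[ℂ] H} {A : ℝ → ℝ}
    (h : IsCauchyOperator L A) {ε : ℝ} (hε : 0 < ε) {f : H}
    (hf : ∀ᵐ y, |y| < ε → f y = 0) (g : H) : ⟪g, L f⟫_ℂ = -⟪L g, f⟫_ℂ := by
  set F : ℝ → ℝ → ℂ := fun x y => (starRingEnd ℂ) (g x) * (cauchyKernel A x y * f y) with hF
  have hAC : MemLp (fun x => (A x : ℂ)) 2 (volume : Measure ℝ) := h.memLp.ofReal
  have hAf : Integrable (fun y => (A y : ℂ) * f y) := hAC.integrable_mul (Lp.memLp f)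
  have hAg : Integrable (fun y => (A y : ℂ) * g y) := hAC.integrable_mul (Lp.memLp g)
  -- Fubini applies because `|k(x, y)| ≤ |A x| |A y| / |y|`, with `|y| ≥ ε` wherever `f y ≠ 0`.
  have hint : Integrable (Function.uncurry F) ((volume : Measure ℝ).prod volume) := by
    refine Integrable.mono' ((hAg.norm.mul_prod hAf.norm).const_mul ε⁻¹) ?_ ?_
    · have h1 : AEStronglyMeasurable (fun z : ℝ × ℝ => (cauchyKernel A z.1 z.2 : ℂ))
          ((volume : Measure ℝ).prod volume) :=
        Complex.continuous_ofReal.comp_aestronglyMeasurable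
          (aestronglyMeasurable_cauchyKernel_prod h.memLp.1)
      have h2 : AEStronglyMeasurable (fun x => (starRingEnd ℂ) (g x)) (volume : Measure ℝ) :=
        Complex.continuous_conj.comp_aestronglyMeasurable (Lp.aestronglyMeasurable g)
      exact h2.comp_fst.mul (h1.mul (Lp.aestronglyMeasurable f).comp_snd)
    · have hf' : ∀ᵐ z ∂((volume : Measure ℝ).prod volume), |z.2| < ε → f z.2 = 0 :=
        Measure.quasiMeasurePreserving_snd.ae hf
      filter_upwards [hf'] with z hz
      simp only [Function.uncurry, hF, norm_mul, RCLike.norm_conj, Complex.norm_real,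
        Real.norm_eq_abs]
      rcases lt_or_ge |z.2| ε with hlt | hge
      · rw [hz hlt]; simp
      · have hk : |cauchyKernel A z.1 z.2| ≤ ε⁻¹ * |A z.2| * |A z.1| := by
          rw [← neg_neg (cauchyKernel A z.1 z.2), ← cauchyKernel_swap, abs_neg]
          refine (abs_cauchyKernel_le A z.2 z.1).trans ?_
          rw [div_eq_inv_mul]
          gcongr
        calc ‖g z.1‖ * (|cauchyKernel A z.1 z.2| * ‖f z.2‖)
            ≤ ‖g z.1‖ * ((ε⁻¹ * |A z.2| * |A z.1|) * ‖f z.2‖) := by gcongr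
          _ = ε⁻¹ * (|A z.1| * ‖g z.1‖ * (|A z.2| * ‖f z.2‖)) := by ring
  have h1 : ⟪g, L f⟫_ℂ = ∫ x, ∫ y, F x y := by
    rw [L2.inner_def]
    refine integral_congr_ae ?_
    filter_upwards [h.kernel f] with x hx
    rw [RCLike.inner_apply, hx.2, ← integral_mul_const]
    refine integral_congr_ae (Filter.Eventually.of_forall fun y => ?_)
    simp only [hF]; ring
  have h2 : -⟪L g, f⟫_ℂ = ∫ y, ∫ x, F x y := by
    rw [L2.inner_def, ← integral_neg]
    refine integral_congr_ae ?_
    filter_upwards [h.kernel g] with y hy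
    rw [RCLike.inner_apply, hy.2, ← integral_conj, ← integral_const_mul, ← integral_neg]
    refine integral_congr_ae (Filter.Eventually.of_forall fun x => ?_)
    simp only [hF, map_mul, Complex.conj_ofReal]
    rw [cauchyKernel_swap]; push_cast; ring
  rw [h1, h2, integral_integral_swap hint]

/-- Absolute convergence of the double integral is only at hand for `f` vanishing near the origin.
Such `f` suffice: `w = (L* + L) g` is orthogonal to all of them, in particular to its own
truncations, so it vanishes away from the origin. -/
theorem IsCauchyOperator.star_eq_neg {L : H →L[ℂ] H} {A : ℝ → ℝ} (h : IsCauchyOperator L A) :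
    star L = -L := by
  rw [eq_neg_iff_add_eq_zero]
  ext1 g
  set w : H := (star L + L) g with hw
  have horth : ∀ ε > 0, ∀ f : H, (∀ᵐ y, |y| < ε → f y = 0) → ⟪w, f⟫_ℂ = 0 := by
    intro ε hε f hf
    have := h.inner_apply_of_vanishing hε hf g
    rw [hw, add_apply, inner_add_left, ContinuousLinearMap.star_eq_adjoint,
      ContinuousLinearMap.adjoint_inner_left, this, neg_add_cancel]
  have hzero : ∀ k : ℕ, ∀ᵐ y, 1 / ((k : ℝ) + 1) ≤ |y| → w y = 0 := by
    intro k
    set S : Set ℝ := {y | 1 / ((k : ℝ) + 1) ≤ |y|} with hS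
    have hSm : MeasurableSet S := measurableSet_le measurable_const measurable_norm
    set f : H := ((Lp.memLp w).indicator hSm).toLp with hf
    have hfc : (f : ℝ → ℂ) =ᵐ[volume] S.indicator w := MemLp.coeFn_toLp _
    have hwf := horth (1 / ((k : ℝ) + 1)) Nat.one_div_pos_of_nat f (by
      filter_upwards [hfc] with y hy hlt
      rw [hy, indicator_of_notMem]
      simpa [hS] using hlt)
    have hff : ⟪f, f⟫_ℂ = 0 := by
      rw [← hwf, L2.inner_def, L2.inner_def]
      refine integral_congr_ae ?_
      filter_upwards [hfc] with y hy
      by_cases hyS : y ∈ S <;> simp [hy, hyS]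
    have hf0 : f = 0 := inner_self_eq_zero.1 hff
    filter_upwards [hfc, (Lp.eq_zero_iff_ae_eq_zero.1 hf0)] with y h1 h2 h3
    rw [h2, indicator_of_mem (show y ∈ S from h3)] at h1
    exact h1.symm
  apply Lp.ext
  filter_upwards [ae_all_iff.2 hzero, Measure.ae_ne volume (0 : ℝ)] with y hy hy0
  obtain ⟨k, hk⟩ := exists_nat_one_div_lt (abs_pos.2 hy0)
  rw [hy k hk.le]
  simp

theorem IsCauchyOperator.isUnit_one_add {L : H →L[ℂ] H} {A : ℝ → ℝ} (h : IsCauchyOperator L A) :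
    IsUnit (1 + L) :=
  isUnit_one_add_of_star_eq_neg h.star_eq_neg

/-! ### Palm steps as Schur complements -/

/-- The real part of the matrix `(K i j)_{i, j ∈ S}` is positive definite. -/
def HasPosRealPart (K : ℝ → ℝ → ℂ) (S : Finset ℝ) : Prop :=
  ∀ c : ℝ → ℂ, (∃ i ∈ S, c i ≠ 0) →
    0 < (∑ i ∈ S, ∑ j ∈ S, (starRingEnd ℂ) (c i) * c j * K i j).re

theorem HasPosRealPart.diag_ne_zero {K : ℝ → ℝ → ℂ} {S : Finset ℝ} (h : HasPosRealPart K S)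
    {a : ℝ} (ha : a ∈ S) : K a a ≠ 0 := by
  intro h0
  have := h (Pi.single a 1) ⟨a, ha, by simp⟩
  simp [Pi.single_apply, ha, h0, apply_ite (starRingEnd ℂ), ite_mul] at this

/-- A Palm step is a Schur complement, so it preserves positivity of the real part. -/
theorem HasPosRealPart.palmStep {K : ℝ → ℝ → ℂ} {S : Finset ℝ} {a : ℝ} (ha : a ∉ S)
    (h : HasPosRealPart K (insert a S)) : HasPosRealPart (palmStep K a) S := by
  have hK : K a a ≠ 0 := h.diag_ne_zero (Finset.mem_insert_self a S)
  rintro c ⟨i, hi, hci⟩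
  -- This value at `a` makes row `a` of `K` annihilate the extended vector, so the form of `K` there
  -- equals the form of the Schur complement at `c`.
  set t : ℂ := -(∑ j ∈ S, c j * K a j) / K a a with ht
  have hia : i ≠ a := ne_of_mem_of_not_mem hi ha
  have key := h (Function.update c a t) ⟨i, Finset.mem_insert_of_mem hi, by
    rwa [Function.update_of_ne hia]⟩
  have hu : ∀ j ∈ S, Function.update c a t j = c j := fun j hj =>
    Function.update_of_ne (ne_of_mem_of_not_mem hj ha) _ _
  convert key using 2
  have hrow : t * K a a + ∑ j ∈ S, c j * K a j = 0 := by
    rw [ht, div_mul_cancel₀ _ hK, neg_add_cancel]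
  have inner_sum : ∀ i, ∑ j ∈ insert a S, (starRingEnd ℂ) (Function.update c a t i) *
      Function.update c a t j * K i j =
      (starRingEnd ℂ) (Function.update c a t i) * (t * K i a + ∑ j ∈ S, c j * K i j) := by
    intro i
    rw [Finset.sum_insert ha, Function.update_self, mul_add, Finset.mul_sum, mul_assoc]
    congr 1
    refine Finset.sum_congr rfl fun j hj => ?_
    rw [hu j hj]; ring
  rw [Finset.sum_congr rfl fun i _ => inner_sum i, Finset.sum_insert ha, hrow, mul_zero, zero_add]
  refine Finset.sum_congr rfl fun i hi => ?_
  rw [hu i hi, PalmKernel.palmStep, if_neg hK]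
  have e : t * K i a = -∑ j ∈ S, c j * (K i a * K a j / K a a) := by
    rw [ht, div_mul_eq_mul_div, neg_mul, neg_div, Finset.sum_mul, Finset.sum_div]
    congr 1
    refine Finset.sum_congr rfl fun j _ => ?_
    ring
  rw [e, neg_add_eq_sub, ← Finset.sum_sub_distrib, Finset.mul_sum]
  refine Finset.sum_congr rfl fun j _ => ?_
  ring

/-- Either order yields the Schur complement at `{a, b}`: the product of the two pivots is the `2 ×
2` determinant, symmetric in `a` and `b`. -/
theorem palmStep_comm {K : ℝ → ℝ → ℂ} {a b : ℝ} (ha : K a a ≠ 0) (hb : K b b ≠ 0)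
    (hab : palmStep K a b b ≠ 0) (hba : palmStep K b a a ≠ 0) :
    palmStep (palmStep K a) b = palmStep (palmStep K b) a := by
  have h1 : palmStep K a = fun x y => K x y - K x a * K a y / K a a := if_neg ha
  have h2 : palmStep K b = fun x y => K x y - K x b * K b y / K b b := if_neg hb
  have hdet : K a a * K b b - K a b * K b a ≠ 0 := by
    intro h0
    apply hab
    rw [h1]
    field_simp
    linear_combination h0
  have ea : palmStep K a b b = (K a a * K b b - K a b * K b a) / K a a := by
    rw [h1]; field_simp
  have eb : palmStep K b a a = (K a a * K b b - K a b * K b a) / K b b := by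
    rw [h2]; field_simp
  have h3 : palmStep (palmStep K a) b = fun x y => palmStep K a x y -
      palmStep K a x b * palmStep K a b y / palmStep K a b b := if_neg hab
  have h4 : palmStep (palmStep K b) a = fun x y => palmStep K b x y -
      palmStep K b x a * palmStep K b a y / palmStep K b a a := if_neg hba
  ext x y
  rw [h3, h4, ea, eb]
  simp only [h1, h2]
  field_simp
  ring

/-- The iterated Palm kernel does not depend on the order of the points. -/
theorem palmKernel_perm {l l' : List ℝ} (hl : l.Perm l') : ∀ {K : ℝ → ℝ → ℂ}, l.Nodup →
    HasPosRealPart K l.toFinset → palmKernel K l = palmKernel K l' := by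
  induction hl with
  | nil => intros; rfl
  | cons a _ ih =>
    intro K hn hP
    rw [List.nodup_cons] at hn
    rw [List.toFinset_cons] at hP
    exact ih hn.2 (hP.palmStep (by simpa using hn.1))
  | swap a b l =>
    intro K hn hP
    have hn' : (a :: b :: l).Nodup := (List.Perm.swap a b l).nodup_iff.1 hn
    have hP' : HasPosRealPart K (a :: b :: l).toFinset := by
      rwa [← List.toFinset_eq_of_perm _ _ (List.Perm.swap a b l)]
    have hb : K b b ≠ 0 := hP.diag_ne_zero (by simp)
    have ha : K a a ≠ 0 := hP.diag_ne_zero (by simp)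
    rw [List.nodup_cons] at hn hn'
    rw [List.toFinset_cons] at hP hP'
    have h1 : palmStep K b a a ≠ 0 :=
      (hP.palmStep (by simpa using hn.1)).diag_ne_zero (by simp)
    have h2 : palmStep K a b b ≠ 0 :=
      (hP'.palmStep (by simpa using hn'.1)).diag_ne_zero (by simp)
    simp only [palmKernel, List.foldl_cons, palmStep_comm ha hb h2 h1]
  | trans h1 _ ih1 ih2 =>
    intro K hn hP
    rw [ih1 hn hP, ih2 (h1.nodup_iff.1 hn) (by rwa [← List.toFinset_eq_of_perm _ _ h1])]

/-! ### Linear independence of the rows -/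

/-- Linear independence of Cauchy functions. -/
theorem eq_zero_of_sum_div_sub_eq_zero {T : Finset ℝ} {a : ℝ → ℂ} {Z : Set ℝ} (hZ : Z.Infinite)
    (hTZ : ∀ q ∈ T, q ∉ Z) (h : ∀ y ∈ Z, ∑ q ∈ T, a q / ((q : ℂ) - y) = 0) :
    ∀ q ∈ T, a q = 0 := by
  classical
  -- The sum with denominators cleared. It has infinitely many roots, hence is zero, and at `z = q`
  -- only the term of `q` survives.
  set P : Polynomial ℂ := ∑ q ∈ T, Polynomial.C (a q) *
    ∏ k ∈ T.erase q, (Polynomial.C (k : ℂ) - Polynomial.X) with hPdef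
  have hev : ∀ z : ℂ, P.eval z = ∑ q ∈ T, a q * ∏ k ∈ T.erase q, ((k : ℂ) - z) := by
    intro z
    simp [hPdef, Polynomial.eval_finsetSum, Polynomial.eval_prod]
  have hP : P = 0 := by
    refine Polynomial.eq_zero_of_infinite_isRoot P
      ((hZ.image Complex.ofReal_injective.injOn).mono ?_)
    rintro _ ⟨y, hy, rfl⟩
    rw [mem_ofPred_eq, Polynomial.IsRoot, hev]
    calc _ = (∏ k ∈ T, ((k : ℂ) - y)) * ∑ q ∈ T, a q / ((q : ℂ) - y) := by
          rw [Finset.mul_sum]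
          refine Finset.sum_congr rfl fun q hq => ?_
          have hne : (q : ℂ) - y ≠ 0 := by
            rw [← Complex.ofReal_sub, Complex.ofReal_ne_zero, sub_ne_zero]
            rintro rfl
            exact hTZ q hq hy
          rw [← Finset.mul_prod_erase T _ hq]
          field_simp
      _ = 0 := by rw [h y hy, mul_zero]
  intro q hq
  have h0 := hev q
  rw [hP, Polynomial.eval_zero, Finset.sum_eq_single_of_mem q hq] at h0
  · refine (mul_eq_zero.1 h0.symm).resolve_right (Finset.prod_ne_zero_iff.2 fun k hk => ?_)
    rw [← Complex.ofReal_sub, Complex.ofReal_ne_zero, sub_ne_zero]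
    exact Finset.ne_of_mem_erase hk
  · intro b _ hbq
    rw [Finset.prod_eq_zero (Finset.mem_erase.2 ⟨hbq.symm, hq⟩) (sub_self (q : ℂ)), mul_zero]

theorem cauchyKernel_eq_ite (A : ℝ → ℝ) {x y : ℝ} (hx : x ≠ 0) (hy : y ≠ 0) :
    cauchyKernel A x y = if x * y < 0 then A x * A y / (x - y) else 0 := by
  rcases lt_or_gt_of_ne hx with hx | hx <;> rcases lt_or_gt_of_ne hy with hy | hy
  · rw [cauchyKernel_of_neg_neg A hx hy, if_neg (mul_pos_of_neg_of_neg hx hy).not_gt]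
  · rw [cauchyKernel_of_neg_pos A hx hy, if_pos (mul_neg_of_neg_of_pos hx hy)]
  · rw [cauchyKernel_of_pos_neg A hx hy, if_pos (mul_neg_of_pos_of_neg hx hy)]
  · rw [cauchyKernel_of_pos_pos A hx hy, if_neg (mul_pos hx hy).not_gt]

/-- The rows of `cauchyKernel A` at points where `A` does not vanish are linearly independent. -/
theorem sum_smul_cauchyRow_ne_zero {A : ℝ → ℝ} (hA : MemLp A 2 (volume : Measure ℝ))
    (hc : ContinuousOn A {0}ᶜ) (hsupp : ({0}ᶜ : Set ℝ) ⊆ closure (Function.support A))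
    {S : Finset ℝ} (hS : ∀ q ∈ S, q ≠ 0 ∧ A q ≠ 0) {c : ℝ → ℂ} (hcS : ∃ q ∈ S, c q ≠ 0) :
    ∑ q ∈ S, c q • cauchyRow hA q ≠ 0 := by
  intro hw
  obtain ⟨p, hp, hcp⟩ := hcS
  have hp0 := (hS p hp).1
  have hae : (fun y => ∑ q ∈ S, c q * (cauchyKernel A q y : ℂ)) =ᵐ[volume] fun _ => 0 := by
    have h1 : ∀ᵐ y, ∀ q ∈ S, (c q • cauchyRow hA q : H) y = c q * (cauchyKernel A q y : ℂ) := by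
      rw [Filter.eventually_all_finset]
      intro q _
      filter_upwards [Lp.coeFn_smul (c q) (cauchyRow hA q), coeFn_cauchyRow hA q] with y h2 h3
      rw [h2, Pi.smul_apply, h3, smul_eq_mul]
    filter_upwards [h1, Lp.coeFn_finsetSum S fun q => (c q • cauchyRow hA q : H),
      Lp.eq_zero_iff_ae_eq_zero.1 hw] with y h2 h3 h4
    rw [← Finset.sum_congr rfl h2]
    rw [h4] at h3
    simpa using h3.symm
  have hcont : ContinuousOn (fun y => ∑ q ∈ S, c q * (cauchyKernel A q y : ℂ)) {0}ᶜ := by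
    refine continuousOn_finsetSum _ fun q hq => continuousOn_const.mul ?_
    refine Complex.continuous_ofReal.comp_continuousOn ?_
    exact (continuousOn_cauchyKernel hc).comp (f := fun y => (q, y)) (by fun_prop)
      fun y hy => ⟨(hS q hq).1, hy⟩
  have hzero : ∀ y ≠ 0, ∑ q ∈ S, c q * (cauchyKernel A q y : ℂ) = 0 := fun y hy =>
    Measure.eqOn_open_of_ae_eq (ae_restrict_of_ae hae) isOpen_compl_singleton hcont
      continuousOn_const hy
  -- At `y ∈ Z` only the rows of points on the side of `p` are seen, and `A y` can be cancelled.
  -- Full support and continuity of `A` make `Z` infinite.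
  set Z : Set ℝ := {y | p * y < 0} ∩ Function.support A with hZ
  have hZ0 : ∀ y ∈ Z, y ≠ 0 := by
    rintro y ⟨hy, -⟩ rfl
    simp at hy
  have hside : IsOpen {y : ℝ | p * y < 0} := isOpen_lt (by fun_prop) continuous_const
  have hZinf : Z.Infinite := by
    have hmem : -p ∈ {y : ℝ | p * y < 0} := by
      rw [mem_ofPred_eq]; nlinarith [mul_self_pos.2 hp0]
    obtain ⟨y, hy, hyA⟩ := mem_closure_iff.1 (hsupp (neg_ne_zero.2 hp0)) _ hside hmem
    have hyc : ContinuousAt A y :=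
      hc.continuousAt (isOpen_compl_singleton.mem_nhds (hZ0 y ⟨hy, hyA⟩))
    exact infinite_of_mem_nhds y
      (Filter.inter_mem (hside.mem_nhds hy) (hyc.eventually_ne hyA))
  have hT := eq_zero_of_sum_div_sub_eq_zero (T := S.filter fun q => 0 < p * q)
    (a := fun q => c q * A q) hZinf (by
      rintro q hq ⟨hqn, -⟩
      exact (Finset.mem_filter.1 hq).2.not_gt hqn) (by
      intro y hy
      have hAy : (A y : ℂ) ≠ 0 := Complex.ofReal_ne_zero.2 hy.2
      refine (mul_eq_zero.1 ?_).resolve_left hAy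
      rw [← hzero y (hZ0 y hy), Finset.mul_sum, Finset.sum_filter]
      refine Finset.sum_congr rfl fun q hq => ?_
      have hiff : q * y < 0 ↔ 0 < p * q := by
        have hpy : p * y < 0 := hy.1
        have hq0 := (hS q hq).1
        constructor
        · intro hqy
          by_contra! hpq
          nlinarith [mul_pos_of_neg_of_neg hpy hqy, mul_self_nonneg y]
        · intro hpq
          by_contra! hqy
          nlinarith [mul_neg_of_neg_of_pos hpy hpq, mul_self_nonneg p]
      rw [cauchyKernel_eq_ite A (hS q hq).1 (hZ0 y hy)]
      by_cases hq' : 0 < p * q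
      · rw [if_pos hq', if_pos (hiff.2 hq')]; push_cast; ring
      · rw [if_neg hq', if_neg (hiff.not.2 hq')]; simp) p
    (Finset.mem_filter.2 ⟨hp, mul_self_pos.2 hp0⟩)
  exact mul_ne_zero hcp (Complex.ofReal_ne_zero.2 (hS p hp).2) hT

/-! ### The resolvent kernel and its positivity -/

section Resolvent

variable {L : H →L[ℂ] H} {A : ℝ → ℝ}

theorem IsCauchyOperator.inverse_apply_add (h : IsCauchyOperator L A) (f : H) :
    Ring.inverse (1 + L) f + L (Ring.inverse (1 + L) f) = f := by
  have := congrArg (fun T : H →L[ℂ] H => T f) (Ring.mul_inverse_cancel _ h.isUnit_one_add)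
  simpa using this

theorem IsCauchyOperator.star_inverse_apply_sub (h : IsCauchyOperator L A) (f : H) :
    star (Ring.inverse (1 + L)) f - L (star (Ring.inverse (1 + L)) f) = f := by
  have h1 : (1 + star L) * star (Ring.inverse (1 + L)) = 1 := by
    have h2 : (1 : H →L[ℂ] H) + star L = star (1 + L) := by rw [star_add, star_one]
    rw [h2, ← star_mul, Ring.inverse_mul_cancel _ h.isUnit_one_add, star_one]
  rw [h.star_eq_neg, ← sub_eq_add_neg] at h1
  simpa using congrArg (fun T : H →L[ℂ] H => T f) h1

theorem inner_star_apply (R : H →L[ℂ] H) (f g : H) : ⟪star R f, g⟫_ℂ = ⟪f, R g⟫_ℂ :=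
  ContinuousLinearMap.adjoint_inner_left R g f

theorem inner_star_apply_right (R : H →L[ℂ] H) (f g : H) : ⟪f, star R g⟫_ℂ = ⟪R f, g⟫_ℂ :=
  ContinuousLinearMap.adjoint_inner_right R f g

/-- The continuous kernel of `L (1 + L)⁻¹`. -/
def IsCauchyOperator.resolventKernel (h : IsCauchyOperator L A) (x y : ℝ) : ℂ :=
  cauchyKernel A x y + ⟪cauchyRow h.memLp x, Ring.inverse (1 + L) (cauchyRow h.memLp y)⟫_ℂ

/-- As `L* = -L`, the operator `R*` inverts `1 - L`, so `s = R* r_x` satisfies `s = r_x + L s`.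
Reading `(L s)(y)` as `⟪r_y, s⟫` and conjugating gives the row. -/
theorem IsCauchyOperator.isRow_resolventKernel (h : IsCauchyOperator L A) (x : ℝ) :
    IsRow (h.resolventKernel x)
      (innerSL ℂ (star (Ring.inverse (1 + L)) (cauchyRow h.memLp x))) := by
  refine isRow_inner ?_
  set r := cauchyRow h.memLp x with hr
  set s := star (Ring.inverse (1 + L)) r with hs
  have hsL : s = r + L s := by
    rw [← sub_eq_iff_eq_add]; exact h.star_inverse_apply_sub r
  filter_upwards [h.ae_apply s, coeFn_cauchyRow h.memLp x, Lp.coeFn_add r (L s)] with y h1 h2 h3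
  rw [hsL, h3, Pi.add_apply, map_add, h2, h1, Complex.conj_ofReal, inner_conj_symm,
    inner_star_apply]
  rfl

theorem IsCauchyOperator.coeFn_resolventKernel_col (h : IsCauchyOperator L A) (y : ℝ) :
    ((-(Ring.inverse (1 + L) (cauchyRow h.memLp y)) : H) : ℝ → ℂ) =ᵐ[volume]
      fun x => h.resolventKernel x y := by
  set r := cauchyRow h.memLp y with hr
  set s := Ring.inverse (1 + L) r with hs
  have hsL : -s = L s - r := by
    rw [← h.inverse_apply_add r, ← hs]; abel
  filter_upwards [h.ae_apply s, coeFn_cauchyRow h.memLp y, Lp.coeFn_sub (L s) r] with x h1 h2 h3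
  rw [hsL, h3, Pi.sub_apply, h1, h2, cauchyKernel_swap, resolventKernel]
  push_cast
  ring

theorem IsCauchyOperator.isContinuousKernel_resolventKernel (h : IsCauchyOperator L A) :
    IsContinuousKernel h.resolventKernel (KOp L) := by
  constructor
  · refine (Complex.continuous_ofReal.comp_continuousOn
      (continuousOn_cauchyKernel h.continuousOn)).add ?_
    have hr := continuousOn_cauchyRow h.memLp h.continuousOn
    refine ContinuousOn.inner (hr.comp continuousOn_fst fun z hz => hz.1) ?_
    exact (Ring.inverse (1 + L)).continuous.comp_continuousOn
      (hr.comp continuousOn_snd fun z hz => hz.2)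
  · intro f
    filter_upwards [h.ae_apply (Ring.inverse (1 + L) f)] with x hx
    have hrow := h.isRow_resolventKernel x f
    refine ⟨hrow.1, ?_⟩
    rw [← hrow.2, innerSL_apply_apply, inner_star_apply, ← hx]
    rfl

/-- With `s = R w` one has `w = s + L s`, and `⟪L s, s⟫` is purely imaginary. -/
theorem IsCauchyOperator.re_inner_inverse (h : IsCauchyOperator L A) (w : H) :
    (⟪w, Ring.inverse (1 + L) w⟫_ℂ).re = ‖Ring.inverse (1 + L) w‖ ^ 2 := by
  set s := Ring.inverse (1 + L) w with hs
  have hw : w = s + L s := (h.inverse_apply_add w).symm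
  have hskew : (⟪L s, s⟫_ℂ).re = 0 := by
    have h1 : ⟪L s, s⟫_ℂ = -⟪s, L s⟫_ℂ := by
      rw [← inner_star_apply_right, h.star_eq_neg]; simp
    have h2 : (⟪s, L s⟫_ℂ).re = (⟪L s, s⟫_ℂ).re := inner_re_symm (𝕜 := ℂ) s (L s)
    have h3 := congrArg Complex.re h1
    rw [Complex.neg_re, h2] at h3
    linarith
  nth_rewrite 1 [hw]
  rw [inner_add_left, Complex.add_re, hskew, add_zero]
  exact inner_self_eq_norm_sq (𝕜 := ℂ) s

theorem IsCauchyOperator.hasPosRealPart (h : IsCauchyOperator L A)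
    (hsupp : ({0}ᶜ : Set ℝ) ⊆ closure (Function.support A)) {S : Finset ℝ}
    (hS : ∀ q ∈ S, q ≠ 0 ∧ A q ≠ 0) {K : ℝ → ℝ → ℂ} (hK : IsContinuousKernel K (KOp L)) :
    HasPosRealPart K S := by
  intro c hcS
  set w : H := ∑ q ∈ S, c q • cauchyRow h.memLp q with hwdef
  have hw : w ≠ 0 := sum_smul_cauchyRow_ne_zero h.memLp h.continuousOn hsupp hS hcS
  have hs : Ring.inverse (1 + L) w ≠ 0 := by
    intro h0
    have := h.inverse_apply_add w
    rw [h0] at this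
    exact hw (by simpa using this.symm)
  have hsum : ∑ i ∈ S, ∑ j ∈ S, (starRingEnd ℂ) (c i) * c j * K i j =
      (∑ i ∈ S, ∑ j ∈ S, (starRingEnd ℂ) (c i) * c j * (cauchyKernel A i j : ℂ)) +
        ⟪w, Ring.inverse (1 + L) w⟫_ℂ := by
    rw [hwdef, map_sum, sum_inner, ← Finset.sum_add_distrib]
    refine Finset.sum_congr rfl fun i hi => ?_
    rw [inner_sum, ← Finset.sum_add_distrib]
    refine Finset.sum_congr rfl fun j hj => ?_
    rw [hK.unique h.isContinuousKernel_resolventKernel (hS i hi).1 (hS j hj).1,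
      IsCauchyOperator.resolventKernel, map_smul, inner_smul_left, inner_smul_right]
    ring
  have hskew : (∑ i ∈ S, ∑ j ∈ S, (starRingEnd ℂ) (c i) * c j * (cauchyKernel A i j : ℂ)).re =
      0 := by
    set Q := ∑ i ∈ S, ∑ j ∈ S, (starRingEnd ℂ) (c i) * c j * (cauchyKernel A i j : ℂ) with hQ
    have h1 : (starRingEnd ℂ) Q = -Q := by
      rw [hQ, map_sum, Finset.sum_congr rfl fun i _ => map_sum _ _ _, Finset.sum_comm,
        ← Finset.sum_neg_distrib]
      refine Finset.sum_congr rfl fun i _ => ?_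
      rw [← Finset.sum_neg_distrib]
      refine Finset.sum_congr rfl fun j _ => ?_
      rw [map_mul, map_mul, Complex.conj_conj, Complex.conj_ofReal, cauchyKernel_swap]
      push_cast
      ring
    have h2 := congrArg Complex.re h1
    rw [Complex.conj_re, Complex.neg_re] at h2
    linarith
  rw [hsum, Complex.add_re, hskew, zero_add, h.re_inner_inverse]
  positivity

end Resolvent

/-! ### The weight and the operator `g L g` -/

section Weight

variable {n : ℕ} {pp pm : Fin n → ℝ}

theorem weight_of_pos (pp pm : Fin n → ℝ) {x : ℝ} (hx : 0 < x) :
    weight pp pm x = ∏ i, (x - pp i) / (x - pm i) := by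
  simp [weight, hx, hx.le]

theorem weight_of_neg (pp pm : Fin n → ℝ) {x : ℝ} (hx : x < 0) :
    weight pp pm x = ∏ i, (x - pm i) / (x - pp i) := by
  simp [weight, hx, hx.le]

theorem weight_succ (pp pm : Fin (n + 1) → ℝ) (x : ℝ) :
    weight pp pm x = weight (fun i => pp i.succ) (fun i => pm i.succ) x *
      weight (fun _ : Fin 1 => pp 0) (fun _ => pm 0) x := by
  simp only [weight, Fin.prod_univ_succ, Fin.prod_univ_zero, mul_one]
  ring

theorem continuousOn_weight (hpp : ∀ i, 0 < pp i) (hpm : ∀ i, pm i < 0) :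
    ContinuousOn (weight pp pm) {0}ᶜ := by
  intro x hx
  apply ContinuousAt.continuousWithinAt
  rcases lt_or_gt_of_ne (show x ≠ 0 from hx) with hx | hx
  · have : ContinuousAt (fun x => ∏ i, (x - pm i) / (x - pp i)) x := by
      refine tendsto_finsetProd _ fun i _ => ?_
      exact ContinuousAt.div (by fun_prop) (by fun_prop) (by linarith [hpp i])
    refine this.congr ?_
    filter_upwards [gt_mem_nhds hx] with z hz
    exact (weight_of_neg pp pm hz).symm
  · have : ContinuousAt (fun x => ∏ i, (x - pp i) / (x - pm i)) x := by
      refine tendsto_finsetProd _ fun i _ => ?_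
      exact ContinuousAt.div (by fun_prop) (by fun_prop) (by linarith [hpm i])
    refine this.congr ?_
    filter_upwards [lt_mem_nhds hx] with z hz
    exact (weight_of_pos pp pm hz).symm

theorem memLp_weight_mul (hpp : ∀ i, 0 < pp i) (hpm : ∀ i, pm i < 0) {A : ℝ → ℝ}
    (hA : MemLp A 2 (volume : Measure ℝ)) :
    MemLp (fun x => weight pp pm x * A x) 2 (volume : Measure ℝ) := by
  have hw : MemLp (weight pp pm) ∞ (volume : Measure ℝ) := by
    simpa using (weight_memLp hpp hpm).re
  exact hA.mul hw

theorem cauchyKernel_mul (g A : ℝ → ℝ) (x y : ℝ) :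
    cauchyKernel (fun x => g x * A x) x y = g x * cauchyKernel A x y * g y := by
  have h1 : ∀ x, posPart (fun x => g x * A x) x = g x * posPart A x := fun x => by
    by_cases h : x ∈ Ioi (0 : ℝ) <;> simp [posPart, h]
  have h2 : ∀ x, negPart (fun x => g x * A x) x = g x * negPart A x := fun x => by
    by_cases h : x ∈ Iio (0 : ℝ) <;> simp [negPart, h]
  rw [cauchyKernel, cauchyKernel, h1, h1, h2, h2]
  ring

theorem coeFn_mulOp (g : ℝ → ℝ) (hg : MemLp (fun x => (g x : ℂ)) ∞ (volume : Measure ℝ)) (f : H) :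
    (mulOp g hg f : ℝ → ℂ) =ᵐ[volume] fun x => g x * f x := by
  rw [mulOp, ContinuousLinearMap.holderL_apply_apply]
  filter_upwards [ContinuousLinearMap.coeFn_holder (r := 2) (ContinuousLinearMap.mul ℂ ℂ)
    hg.toLp f, hg.coeFn_toLp] with x h1 h2
  rw [h1, h2, ContinuousLinearMap.mul_apply']

theorem IsCauchyOperator.weightConj {L : H →L[ℂ] H} {A : ℝ → ℝ} (h : IsCauchyOperator L A)
    (hpp : ∀ i, 0 < pp i) (hpm : ∀ i, pm i < 0) :
    IsCauchyOperator (weightConj pp pm hpp hpm L) (fun x => weight pp pm x * A x) where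
  continuousOn := (continuousOn_weight hpp hpm).mul h.continuousOn
  memLp := memLp_weight_mul hpp hpm h.memLp
  kernel := by
    intro f
    set M := mulOp (weight pp pm) (weight_memLp hpp hpm) with hM
    filter_upwards [h.kernel (M f), coeFn_mulOp _ (weight_memLp hpp hpm) (L (M f))] with x hx h1
    have e : (fun y => (weight pp pm x : ℂ) * (cauchyKernel A x y * M f y)) =ᵐ[volume]
        fun y => (cauchyKernel (fun x => weight pp pm x * A x) x y : ℂ) * f y := by
      filter_upwards [coeFn_mulOp _ (weight_memLp hpp hpm) f] with y hy
      rw [hM, hy, cauchyKernel_mul]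
      push_cast
      ring
    refine ⟨(hx.1.const_mul _).congr e, ?_⟩
    rw [← integral_congr_ae e, integral_const_mul, ← hx.2, ← h1]
    rfl

end Weight

/-! ### Reduction at one pair -/

/-- `g L g` for the weight of a single pair is a Schur complement of `L` on the pair. -/
theorem cauchyKernel_pairWeight (A : ℝ → ℝ) {p m : ℝ} (hp : 0 < p) (hm : m < 0)
    (hAp : A p ≠ 0) (hAm : A m ≠ 0) {x y : ℝ} (hx : x ≠ 0) (hy : y ≠ 0) :
    cauchyKernel A x y - -(cauchyKernel A p m)⁻¹ * (cauchyKernel A x p * cauchyKernel A m y) -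
      (cauchyKernel A p m)⁻¹ * (cauchyKernel A x m * cauchyKernel A p y) =
    cauchyKernel (fun x => weight (fun _ : Fin 1 => p) (fun _ => m) x * A x) x y := by
  have hpm : p - m ≠ 0 := by linarith
  rw [cauchyKernel_mul, cauchyKernel_of_pos_neg A hp hm]
  -- For equal signs everything vanishes. For opposite signs exactly one correction survives, `A p`
  -- and `A m` cancel, and the `2 × 2` Cauchy determinant identity remains.
  rcases lt_or_gt_of_ne hx with hx | hx <;> rcases lt_or_gt_of_ne hy with hy | hy
  · rw [cauchyKernel_of_neg_neg A hx hy, cauchyKernel_of_neg_neg A hm hy,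
      cauchyKernel_of_neg_neg A hx hm]
    simp
  · rw [cauchyKernel_of_neg_pos A hx hy, cauchyKernel_of_neg_pos A hx hp,
      cauchyKernel_of_neg_pos A hm hy, cauchyKernel_of_neg_neg A hx hm, weight_of_neg _ _ hx,
      weight_of_pos _ _ hy]
    simp only [Fin.prod_univ_one]
    have h1 : x - y ≠ 0 := by linarith
    have h2 : x - p ≠ 0 := by linarith
    have h3 : m - y ≠ 0 := by linarith
    have h4 : y - m ≠ 0 := by linarith
    field_simp
    ring
  · rw [cauchyKernel_of_pos_neg A hx hy, cauchyKernel_of_pos_neg A hx hm,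
      cauchyKernel_of_pos_neg A hp hy, cauchyKernel_of_pos_pos A hx hp, weight_of_pos _ _ hx,
      weight_of_neg _ _ hy]
    simp only [Fin.prod_univ_one]
    have h1 : x - y ≠ 0 := by linarith
    have h2 : x - m ≠ 0 := by linarith
    have h3 : p - y ≠ 0 := by linarith
    have h4 : y - p ≠ 0 := by linarith
    field_simp
    ring
  · rw [cauchyKernel_of_pos_pos A hx hy, cauchyKernel_of_pos_pos A hx hp,
      cauchyKernel_of_pos_pos A hp hy]
    simp

theorem IsRow.congr {b b' : ℝ → ℂ} {φ : H →L[ℂ] ℂ} (h : IsRow b φ) (hb : ∀ y ≠ 0, b y = b' y) :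
    IsRow b' φ := by
  intro f
  have e : (fun y => b y * f y) =ᵐ[volume] fun y => b' y * f y := by
    filter_upwards [Measure.ae_ne volume (0 : ℝ)] with y hy
    rw [hb y hy]
  exact ⟨(h f).1.congr e, (h f).2.trans (integral_congr_ae e)⟩

theorem continuousOn_palmStep {K : ℝ → ℝ → ℂ} {q : ℝ} (hq : q ≠ 0)
    (hK : ContinuousOn (fun z : ℝ × ℝ => K z.1 z.2) ({0}ᶜ ×ˢ {0}ᶜ)) :
    ContinuousOn (fun z : ℝ × ℝ => palmStep K q z.1 z.2) ({0}ᶜ ×ˢ {0}ᶜ) := by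
  by_cases h : K q q = 0
  · simpa only [palmStep, if_pos h] using hK
  · simp only [palmStep, if_neg h]
    have h1 : ContinuousOn (fun z : ℝ × ℝ => K z.1 q) ({0}ᶜ ×ˢ {0}ᶜ) :=
      hK.comp (f := fun z : ℝ × ℝ => (z.1, q)) (by fun_prop) fun z hz => ⟨hz.1, hq⟩
    have h2 : ContinuousOn (fun z : ℝ × ℝ => K q z.2) ({0}ᶜ ×ˢ {0}ᶜ) :=
      hK.comp (f := fun z : ℝ × ℝ => (q, z.2)) (by fun_prop) fun z hz => ⟨hq, hz.2⟩
    exact hK.sub ((h1.mul h2).div_const _)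

/-- The Palm reduction at a pair `p > 0 > m` corresponds to conjugating `L` by the weight of
that pair. -/
theorem IsCauchyOperator.palm_pair {L : H →L[ℂ] H} {A : ℝ → ℝ} (h : IsCauchyOperator L A)
    {p m : ℝ} (hp : 0 < p) (hm : m < 0) (hAp : A p ≠ 0) (hAm : A m ≠ 0) {K : ℝ → ℝ → ℂ}
    (hK : IsContinuousKernel K (KOp L)) (hKp : K p p ≠ 0) (hKm : palmStep K p m m ≠ 0) :
    ∃ L' : H →L[ℂ] H, IsCauchyOperator L'
        (fun x => weight (fun _ : Fin 1 => p) (fun _ => m) x * A x) ∧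
      IsContinuousKernel (palmStep (palmStep K p) m) (KOp L') := by
  have hK0 : ∀ x y, x ≠ 0 → y ≠ 0 → h.resolventKernel x y = K x y := fun x y hx hy =>
    h.isContinuousKernel_resolventKernel.unique hK hx hy
  set r := cauchyRow h.memLp with hr
  set R := Ring.inverse (1 + L) with hR
  set d : ℂ := ((cauchyKernel A p m : ℝ) : ℂ) with hd
  have hd0 : d ≠ 0 := by
    rw [hd, cauchyKernel_of_pos_neg A hp hm, Complex.ofReal_ne_zero]
    exact div_ne_zero (mul_ne_zero hAp hAm) (by linarith)
  have hcol : ∀ q, ((-r q : H) : ℝ → ℂ) =ᵐ[volume] fun x => (cauchyKernel A x q : ℂ) := by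
    intro q
    filter_upwards [coeFn_cauchyRow h.memLp q, Lp.coeFn_neg (r q)] with x h1 h2
    rw [h2, Pi.neg_apply, h1, cauchyKernel_swap]
    push_cast
    ring
  -- The Schur complement of `L` at the pair: the block of `k` is `(0, d; -d, 0)`, with inverse `(0,
  -- -d⁻¹; d⁻¹, 0)`, and column `q` of `k` is `-r q`.
  set L' : H →L[ℂ] H := L - (-d⁻¹) • (innerSL ℂ (r m)).smulRight (-r p) -
    d⁻¹ • (innerSL ℂ (r p)).smulRight (-r m) with hL'
  have hL'C : IsCauchyOperator L'
      (fun x => weight (fun _ : Fin 1 => p) (fun _ => m) x * A x) := by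
    refine ⟨(continuousOn_weight (fun _ => hp) fun _ => hm).mul h.continuousOn,
      memLp_weight_mul (fun _ => hp) (fun _ => hm) h.memLp, ?_⟩
    refine ((h.kernel.sub_rankOne (hcol p) (isRow_cauchyRow h.memLp m) (-d⁻¹)).sub_rankOne
      (hcol m) (isRow_cauchyRow h.memLp p) d⁻¹).congr fun x y hx hy => ?_
    rw [← cauchyKernel_pairWeight A hp hm hAp hAm hx hy, hd]
    push_cast
    ring
  refine ⟨L', hL'C, continuousOn_palmStep hm.ne (continuousOn_palmStep hp.ne' hK.1), ?_⟩
  have hrow : ∀ q, q ≠ 0 → IsRow (K q) (innerSL ℂ (star R (r q))) := fun q hq =>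
    (h.isRow_resolventKernel q).congr fun y hy => hK0 q y hq hy
  have hcolK : ∀ q, q ≠ 0 → ((-(R (r q)) : H) : ℝ → ℂ) =ᵐ[volume] fun x => K x q := by
    intro q hq
    filter_upwards [h.coeFn_resolventKernel_col q, Measure.ae_ne volume (0 : ℝ)] with x h1 hx
    rw [h1, hK0 x q hx hq]
  -- `ψ` and `φ` realize column and row `m` of `palmStep K p`.
  set ψ : H := -(R (r m)) - (K p m / K p p) • -(R (r p)) with hψ
  set φ : H →L[ℂ] ℂ := innerSL ℂ (star R (r m)) - (K m p / K p p) • innerSL ℂ (star R (r p))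
    with hφ
  have hψK : (ψ : ℝ → ℂ) =ᵐ[volume] fun x => K x m - K p m / K p p * K x p := by
    filter_upwards [hcolK p hp.ne', hcolK m hm.ne,
      Lp.coeFn_sub (-(R (r m))) ((K p m / K p p) • -(R (r p))),
      Lp.coeFn_smul (K p m / K p p) (-(R (r p)))] with x h1 h2 h3 h4
    rw [hψ, h3, Pi.sub_apply, h4, Pi.smul_apply, h1, h2, smul_eq_mul]
  set δ : ℂ := palmStep K p m m with hδ
  have hstep : palmStep K p = fun x y => K x y - K x p * K p y / K p p := if_neg hKp
  have hstep2 : palmStep (palmStep K p) m = fun x y => palmStep K p x y -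
      palmStep K p x m * palmStep K p m y / δ := if_neg hKm
  have hT := (hK.2.sub_rankOne (hcolK p hp.ne') (hrow p hp.ne') (K p p)⁻¹).sub_rankOne hψK
    ((hrow m hm.ne).sub_const_mul (hrow p hp.ne') (K m p / K p p)) δ⁻¹
  rw [← hφ] at hT
  have hop : KOp L' = KOp L - (K p p)⁻¹ • (innerSL ℂ (star R (r p))).smulRight (-(R (r p))) -
      δ⁻¹ • φ.smulRight ψ := by
    refine kOp_eq_of_mul_eq_one hL'C.isUnit_one_add ?_
    ext1 f
    have hval : ∀ q q', q ≠ 0 → q' ≠ 0 → ⟪r q, R (r q')⟫_ℂ = K q q' - cauchyKernel A q q' := by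
      intro q q' hq hq'
      rw [← hK0 q q' hq hq', IsCauchyOperator.resolventKernel]
      ring
    have hLR : ∀ g, L (R g) = g - R g := fun g => eq_sub_of_add_eq' (h.inverse_apply_add g)
    have hKf : KOp L f = f - R f := hLR f
    have hpp := hval p p hp.ne' hp.ne'
    have hpm := hval p m hp.ne' hm.ne
    have hmp := hval m p hm.ne hp.ne'
    have hmm := hval m m hm.ne hm.ne
    rw [cauchyKernel_self, Complex.ofReal_zero, sub_zero] at hpp hmm
    rw [cauchyKernel_swap, Complex.ofReal_neg] at hmp
    rw [← hd] at hpm hmp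
    have hδ' : δ = K m m - K m p * K p m / K p p := by rw [hδ, hstep]
    set a := ⟪r p, R f⟫_ℂ with ha
    set b := ⟪r m, R f⟫_ℂ with hb
    -- `(α, β)` solves the system with matrix `K` on the pair and right side `(a, b)`, by
    -- eliminating at `p` with remaining pivot `δ`.
    set β : ℂ := δ⁻¹ * (b - K m p / K p p * a) with hβ
    set α : ℂ := (K p p)⁻¹ * a - β * (K p m / K p p) with hα
    set w : H := R f - α • R (r p) - β • R (r m) with hw
    have hαβp : α * K p p + β * K p m = a := by
      rw [hα]; field_simp; ring
    have hαβm : α * K m p + β * K m m = b := by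
      have e1 : β * δ = b - K m p / K p p * a := by rw [hβ]; field_simp
      rw [hδ'] at e1
      rw [hα]
      linear_combination e1
    have hTw : (1 - (KOp L - (K p p)⁻¹ • (innerSL ℂ (star R (r p))).smulRight (-(R (r p))) -
        δ⁻¹ • φ.smulRight ψ)) f = w := by
      have hφf : φ f = b - K m p / K p p * a := by
        simp [hφ, inner_star_apply, ha, hb]
      have hφp : innerSL ℂ (star R (r p)) f = a := by
        rw [innerSL_apply_apply, inner_star_apply]
      simp only [sub_apply, one_apply_eq_self, smul_apply, ContinuousLinearMap.smulRight_apply, hφf, hφp,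
        hKf, hψ, hw, hα, hβ]
      module
    -- The system cancels the `K` terms, leaving the contribution of `k(p, m)` alone. Since `w + L w
    -- = f - α r_p - β r_m`, the rank-two part of `L'` then restores exactly what is missing from
    -- `f`.
    have hwp : ⟪r p, w⟫_ℂ = d * β := by
      rw [hw, inner_sub_right, inner_sub_right, inner_smul_right, inner_smul_right, hpp, hpm,
        ← ha]
      linear_combination -hαβp
    have hwm : ⟪r m, w⟫_ℂ = -(d * α) := by
      rw [hw, inner_sub_right, inner_sub_right, inner_smul_right, inner_smul_right, hmp, hmm,
        ← hb]
      linear_combination -hαβm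
    have hLw : L w = f - R f - α • (r p - R (r p)) - β • (r m - R (r m)) := by
      rw [hw, map_sub, map_sub, map_smul, map_smul, hLR, hLR, hLR]
    rw [mul_apply_eq_comp, hTw]
    simp only [add_apply, one_apply_eq_self, hL', sub_apply, smul_apply,
      ContinuousLinearMap.smulRight_apply, innerSL_apply_apply, hwp, hwm, hLw]
    have e1 : -d⁻¹ * -(d * α) = α := by field_simp
    have e2 : d⁻¹ * (d * β) = β := by field_simp
    rw [smul_smul, smul_smul, e1, e2, hw]
    module
  rw [hop]
  convert hT using 3 with x y
  rw [hstep2, hstep]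
  ring

/-! ### Induction on the number of pairs -/

theorem nodup_ofFn_append_ofFn {n : ℕ} {pp pm : Fin n → ℝ} (hpp : ∀ i, 0 < pp i)
    (hpm : ∀ i, pm i < 0) (hpp_inj : Function.Injective pp) (hpm_inj : Function.Injective pm) :
    (List.ofFn pp ++ List.ofFn pm).Nodup := by
  rw [List.nodup_append', List.nodup_ofFn, List.nodup_ofFn]
  refine ⟨hpp_inj, hpm_inj, ?_⟩
  intro a ha hb
  obtain ⟨i, rfl⟩ := (List.mem_ofFn' pp a).1 ha
  obtain ⟨j, hj⟩ := (List.mem_ofFn' pm _).1 hb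
  linarith [hpp i, hpm j]

theorem palmKernel_eq_of_weight {n : ℕ} : ∀ {pp pm : Fin n → ℝ} {L L' : H →L[ℂ] H} {A : ℝ → ℝ}
    {K K' : ℝ → ℝ → ℂ}, (∀ i, 0 < pp i) → (∀ i, pm i < 0) → Function.Injective pp →
    Function.Injective pm → (∀ i, A (pp i) ≠ 0) → (∀ i, A (pm i) ≠ 0) → IsCauchyOperator L A →
    IsCauchyOperator L' (fun x => weight pp pm x * A x) → IsContinuousKernel K (KOp L) →
    IsContinuousKernel K' (KOp L') → HasPosRealPart K (List.ofFn pp ++ List.ofFn pm).toFinset →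
    ∀ x y : ℝ, x ≠ 0 → y ≠ 0 → palmKernel K (List.ofFn pp ++ List.ofFn pm) x y = K' x y := by
  induction n with
  | zero =>
    intro pp pm L L' A K K' _ _ _ _ _ _ hL hL' hK hK' _ x y hx hy
    have hLL : L = L' := by
      refine hL.kernel.operator_unique ?_
      simpa [weight] using hL'.kernel
    subst hLL
    simpa [palmKernel] using hK.unique hK' hx hy
  | succ n ih =>
    intro pp pm L L' A K K' hpp hpm hppi hpmi hApp hApm hL hL' hK hK' hP x y hx hy
    set l := List.ofFn (fun i : Fin n => pp i.succ) ++ List.ofFn (fun i : Fin n => pm i.succ)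
      with hl
    have hperm : (List.ofFn pp ++ List.ofFn pm).Perm (pp 0 :: pm 0 :: l) := by
      rw [List.ofFn_succ, List.ofFn_succ, List.cons_append]
      exact List.perm_middle.cons _
    have hnd := nodup_ofFn_append_ofFn hpp hpm hppi hpmi
    rw [palmKernel_perm hperm hnd hP]
    have hnd' := hperm.nodup_iff.1 hnd
    rw [List.toFinset_eq_of_perm _ _ hperm, List.toFinset_cons] at hP
    rw [List.nodup_cons, List.nodup_cons] at hnd'
    have hK0 : K (pp 0) (pp 0) ≠ 0 := hP.diag_ne_zero (by simp)
    have hP1 := hP.palmStep (by simpa using hnd'.1)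
    have hK1 : palmStep K (pp 0) (pm 0) (pm 0) ≠ 0 := hP1.diag_ne_zero (by simp)
    rw [List.toFinset_cons] at hP1
    have hP2 := hP1.palmStep (by simpa using hnd'.2.1)
    obtain ⟨L₁, hL₁, hKL₁⟩ := hL.palm_pair (hpp 0) (hpm 0) (hApp 0) (hApm 0) hK hK0 hK1
    refine ih (fun i => hpp i.succ) (fun i => hpm i.succ)
      (hppi.comp (Fin.succ_injective n)) (hpmi.comp (Fin.succ_injective n))
      (fun i => ?_) (fun i => ?_) hL₁ ?_ hKL₁ hK' hP2 x y hx hy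
    -- The pair weight vanishes on `ℝ*` only at `pp 0` and `pm 0`, so distinctness keeps the new
    -- amplitude nonzero at the remaining points.
    · rw [weight_of_pos _ _ (hpp i.succ), Fin.prod_univ_one]
      refine mul_ne_zero (div_ne_zero (sub_ne_zero.2 fun e => Fin.succ_ne_zero i (hppi e)) ?_)
        (hApp _)
      linarith [hpp i.succ, hpm 0]
    · rw [weight_of_neg _ _ (hpm i.succ), Fin.prod_univ_one]
      refine mul_ne_zero (div_ne_zero (sub_ne_zero.2 fun e => Fin.succ_ne_zero i (hpmi e)) ?_)
        (hApm _)
      linarith [hpm i.succ, hpp 0]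
    · simpa only [weight_succ pp pm, mul_assoc] using hL'

end

end PalmKernel

open PalmKernel in
theorem mainTheorem10 (L : H →L[ℂ] H) (A : ℝ → ℝ) (hL : IsAdmissible L A)
    (n : ℕ) (pp pm : Fin n → ℝ)
    (hpp : ∀ i, 0 < pp i) (hpm : ∀ i, pm i < 0)
    (hpp_inj : Function.Injective pp) (hpm_inj : Function.Injective pm)
    (hApp : ∀ i, A (pp i) ≠ 0) (hApm : ∀ i, A (pm i) ≠ 0) :
    IsUnit (1 + L) ∧ IsUnit (1 + weightConj pp pm hpp hpm L) ∧
    (∃ K, IsContinuousKernel K (KOp L)) ∧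
    (∃ K', IsContinuousKernel K' (KOp (weightConj pp pm hpp hpm L))) ∧
    ∀ K K' : ℝ → ℝ → ℂ,
      IsContinuousKernel K (KOp L) →
      IsContinuousKernel K' (KOp (weightConj pp pm hpp hpm L)) →
      ∀ q : List ℝ, q.Perm (List.ofFn pp ++ List.ofFn pm) →
      ∀ x y : ℝ, x ≠ 0 → y ≠ 0 → palmKernel K q x y = K' x y := by
  have hC := hL.isCauchyOperator
  have hC' := hC.weightConj hpp hpm
  refine ⟨hC.isUnit_one_add, hC'.isUnit_one_add, ⟨_, hC.isContinuousKernel_resolventKernel⟩,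
    ⟨_, hC'.isContinuousKernel_resolventKernel⟩, ?_⟩
  intro K K' hK hK' q hq x y hx hy
  have hP : HasPosRealPart K (List.ofFn pp ++ List.ofFn pm).toFinset := by
    refine hC.hasPosRealPart hL.fullSupport (fun a ha => ?_) hK
    rw [List.mem_toFinset, List.mem_append, List.mem_ofFn', List.mem_ofFn'] at ha
    rcases ha with ⟨i, rfl⟩ | ⟨i, rfl⟩
    · exact ⟨(hpp i).ne', hApp i⟩
    · exact ⟨(hpm i).ne, hApm i⟩
  rw [← palmKernel_perm hq.symm (nodup_ofFn_append_ofFn hpp hpm hpp_inj hpm_inj) hP]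
  exact palmKernel_eq_of_weight hpp hpm hpp_inj hpm_inj hApp hApm hC hC' hK hK' hP x y hx hy
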